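/- Let $N\ge 1$, let $A_1,\dots,A_{N+1}$ be distinct points of $\mathbb{R}^2$ (an $N$-hop path), let $p_{A_1},\dots,p_{A_N}>0$ be transmit powers, $\alpha>0$ the path loss exponent, and $\lambda_E>0$. The locations $E_1,E_2,\dots$ of the eavesdroppers form a homogeneous Poisson point process $\Phi_E$ on $\mathbb{R}^2$ of density $\lambda_E$. The channel coefficients $h_{A_iA_{i+1}}$ and $h_{A_kE_j}$ ($1\le i,k\le N$, $j\ge 1$) are complex random variables whose squared moduli are exponentially distributed with mean $1$, mutually independent, and independent of the locations $(E_j)_{j\ge1}$. Writing $d_{XY}$ for Euclidean distance, put $$\mathtt{SNR}_{A_iA_{i+1}}=\frac{p_{A_i}|h_{A_iA_{i+1}}|^2}{d_{A_iA_{i+1}}^{\alpha}},\qquad \mathtt{SNR}_{A_kE_j}=\frac{p_{A_k}|h_{A_kE_j}|^2}{d_{A_kE_j}^{\alpha}},\qquad I_E=\max_{j}\ \sum_{k=1}^N \mathtt{SNR}_{A_kE_j},$$ so that $I_E$ is the largest SNR that a single (non-colluding) eavesdropper obtains by maximal-ratio combining over all hops. The secure connection probability (SCP) of the path is $$\mathcal{P}_N=\mathbb{P}\Bigl(\tfrac1N\bigl(\log_2(1+\min_{1\le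 i\le N}\mathtt{SNR}_{A_iA_{i+1}})-\log_2(1+I_E)\bigr)>0\Bigr).$$ For $x\in\mathbb{R}^2$ let $\lambda_k(x)=p_{A_k}^{-1}d_{A_kx}^{\alpha}$ and $\delta_k(x)=\prod_{m\ne k}\frac{\lambda_m(x)}{\lambda_m(x)-\lambda_k(x)}$ (defined for almost every $x$). Then, almost surely, the maximum $I_E$ exists and the integral over $\mathbb{R}^2$ below converges absolutely, and $$\mathcal{P}_N=\mathbb{E}\left\{\exp\left[-\lambda_E\int_{\mathbb{R}^2}\sum_{k=1}^N\delta_k(x)\exp\Bigl(-d_{A_kx}^{\alpha}\,p_{A_k}^{-1}\min_{1\le i\le N}\mathtt{SNR}_{A_iA_{i+1}}\Bigr)dx\right]\right\},$$ where the expectation is over the legitimate-link coefficients $h_{A_iA_{i+1}}$, $i=1,\dots,N$. -/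

import Mathlib

open MeasureTheory ProbabilityTheory
open scoped NNReal ENNReal

noncomputable section

namespace SecureRouting

/-- The plane `ℝ²` with its Euclidean distance and Lebesgue measure. -/
abbrev Plane : Type := EuclideanSpace ℝ (Fin 2)

/-- The counting measure `∑ j, δ_{E j ω}` of a random sequence of points: its value on a set `B` is
the number of indices `j` with `E j ω ∈ B`. -/
def pointCount {Ω : Type*} (E : ℕ → Ω → Plane) (ω : Ω) : Measure Plane :=
  Measure.sum fun j => Measure.dirac (E j ω)

/-- The random points `E 0, E 1, …` enumerate a homogeneous Poisson point process on the plane with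
density `lam`: the number of points in a Borel set `B` of finite area is Poisson distributed with
mean `lam * area B`, and the numbers of points in disjoint Borel sets are independent. -/
structure IsHomogeneousPPP {Ω : Type*} [MeasurableSpace Ω] (μ : Measure Ω) (lam : ℝ≥0)
    (E : ℕ → Ω → Plane) : Prop where
  measurable : ∀ j, Measurable (E j)
  hasLaw_count : ∀ B : Set Plane, MeasurableSet B → volume B ≠ ∞ →
    HasLaw (fun ω => pointCount E ω B)
      ((poissonMeasure (lam * (volume B).toNNReal)).map (fun n : ℕ => (n : ℝ≥0∞))) μ
  indep_count : ∀ (n : ℕ) (B : Fin n → Set Plane), (∀ i, MeasurableSet (B i)) →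
    Pairwise (fun i j => Disjoint (B i) (B j)) →
    iIndepFun (fun i ω => pointCount E ω (B i)) μ

variable {Ω : Type*} {N : ℕ}

/-- The SNR of the `i`-th hop of the path `A 0, …, A N`, with transmit powers `p`, path loss
exponent `α` and channel coefficients `h`. -/
def linkSNR (A : Fin (N + 1) → Plane) (p : Fin N → ℝ) (α : ℝ) (h : Fin N → Ω → ℂ)
    (i : Fin N) (ω : Ω) : ℝ :=
  p i * ‖h i ω‖ ^ 2 / dist (A i.castSucc) (A i.succ) ^ α

/-- The SNR at the `j`-th eavesdropper of the transmission of the `k`-th hop. -/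
def eveSNR (A : Fin (N + 1) → Plane) (p : Fin N → ℝ) (α : ℝ) (hE : Fin N → ℕ → Ω → ℂ)
    (E : ℕ → Ω → Plane) (k : Fin N) (j : ℕ) (ω : Ω) : ℝ :=
  p k * ‖hE k j ω‖ ^ 2 / dist (A k.castSucc) (E j ω) ^ α

/-- The SNR at the `j`-th eavesdropper after maximal-ratio combining over all hops. -/
def mrcSNR (A : Fin (N + 1) → Plane) (p : Fin N → ℝ) (α : ℝ) (hE : Fin N → ℕ → Ω → ℂ)
    (E : ℕ → Ω → Plane) (j : ℕ) (ω : Ω) : ℝ :=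
  ∑ k, eveSNR A p α hE E k j ω

/-- The end-to-end SNR of the path: the minimum of the SNRs of its hops. -/
def pathSNR (A : Fin (N + 1) → Plane) (p : Fin N → ℝ) (α : ℝ) (h : Fin N → Ω → ℂ) (ω : Ω) : ℝ :=
  ⨅ i, linkSNR A p α h i ω

/-- The eavesdropping SNR for non-colluding eavesdroppers: the maximum over the eavesdroppers of the
combined SNR of each one. -/
def nonColludingSNR (A : Fin (N + 1) → Plane) (p : Fin N → ℝ) (α : ℝ) (hE : Fin N → ℕ → Ω → ℂ)
    (E : ℕ → Ω → Plane) (ω : Ω) : ℝ :=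
  ⨆ j, mrcSNR A p α hE E j ω

/-- The difference of rates whose positivity means that the path is secure. -/
def secrecyRate (A : Fin (N + 1) → Plane) (p : Fin N → ℝ) (α : ℝ) (h : Fin N → Ω → ℂ)
    (hE : Fin N → ℕ → Ω → ℂ) (E : ℕ → Ω → Plane) (ω : Ω) : ℝ :=
  1 / (N : ℝ) * (Real.logb 2 (1 + pathSNR A p α h ω)
    - Real.logb 2 (1 + nonColludingSNR A p α hE E ω))

/-- The secure connection probability of the path against non-colluding eavesdroppers. -/
def scp [MeasurableSpace Ω] (μ : Measure Ω) (A : Fin (N + 1) → Plane) (p : Fin N → ℝ) (α : ℝ)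
    (h : Fin N → Ω → ℂ) (hE : Fin N → ℕ → Ω → ℂ) (E : ℕ → Ω → Plane) : ℝ :=
  μ.real {ω | 0 < secrecyRate A p α h hE E ω}

/-- The rate `λ_k(x)` of the exponentially distributed SNR of the `k`-th transmission at `x`. -/
def rate (A : Fin (N + 1) → Plane) (p : Fin N → ℝ) (α : ℝ) (k : Fin N) (x : Plane) : ℝ :=
  (p k)⁻¹ * dist (A k.castSucc) x ^ α

/-- The hypoexponential coefficient `δ_k(x) = ∏_{m ≠ k} λ_m(x) / (λ_m(x) - λ_k(x))`. -/
def delta (A : Fin (N + 1) → Plane) (p : Fin N → ℝ) (α : ℝ) (k : Fin N) (x : Plane) : ℝ :=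
  ∏ m ∈ Finset.univ.erase k, rate A p α m x / (rate A p α m x - rate A p α k x)

/-- The integrand `∑_k δ_k(x) exp(-d_{A_k x}^α p_k⁻¹ s)` at the level `s` of the path SNR. -/
def integrand (A : Fin (N + 1) → Plane) (p : Fin N → ℝ) (α : ℝ) (s : ℝ) (x : Plane) : ℝ :=
  ∑ k, delta A p α k x * Real.exp (-(dist (A k.castSucc) x ^ α * (p k)⁻¹ * s))

end SecureRouting

end

/-! Fix the legitimate gains, hence the path SNR s, almost surely positive. The path is secure
exactly when every eavesdropper's combined SNR is below s. Given the locations, the eavesdroppers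
are independent, and one at x stays below s with probability 1 - T(x), where T is `snrTail`. The
conditional probability is therefore the product of the 1 - T(E_j), and the Laplace functional of
the Poisson process (`IsHomogeneousPPP.lintegral_expNeg_tsum`) at g = -log(1 - T) turns its mean
into exp(-λ_E ∫ T). Averaging over the legitimate gains gives the outer expectation.

It remains to identify T. The combined SNR at x is a sum of independent exponentials with rates
λ_k(x). Off a null set of circles and lines these rates are distinct, and T is the hypoexponential
tail ∑ δ_k exp(-λ_k s) (`measureReal_le_sum_of_iIndepFun_exp`). Integrability is read off from T as
a probability, by a union bound (`lintegral_snrTail_ne_top`), because the separate terms of the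
formula blow up where rates coincide. The same bound, with Campbell's formula and Borel–Cantelli,
shows that only finitely many eavesdroppers reach a given positive level, so the maximum is
attained. -/

noncomputable section

namespace SecureRouting

open Filter Topology

/-! ### The exponential on [0, ∞] and transforms of the Poisson law -/

/-- The decreasing function `a ↦ exp (-a)` on `[0, ∞]`. -/
def expNeg (a : ℝ≥0∞) : ℝ≥0∞ := EReal.exp (-(a : EReal))

lemma continuous_expNeg : Continuous expNeg :=
  ENNReal.continuous_exp.comp (continuous_neg.comp continuous_coe_ennreal_ereal)

@[fun_prop]
lemma measurable_expNeg : Measurable expNeg := continuous_expNeg.measurable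

lemma antitone_expNeg : Antitone expNeg := fun _ _ h =>
  EReal.exp_monotone (EReal.neg_le_neg_iff.2 (EReal.coe_ennreal_le_coe_ennreal_iff.2 h))

@[simp] lemma expNeg_zero : expNeg 0 = 1 := by simp [expNeg]

lemma expNeg_le_one (a : ℝ≥0∞) : expNeg a ≤ 1 := by
  simpa using antitone_expNeg (zero_le (a := a))

lemma expNeg_add (a b : ℝ≥0∞) : expNeg (a + b) = expNeg a * expNeg b := by
  rw [expNeg, expNeg, expNeg, ← EReal.exp_add, EReal.coe_ennreal_add, EReal.neg_add, sub_eq_add_neg]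
  · left; simp
  · right; simp

lemma expNeg_sum {ι : Type*} (s : Finset ι) (f : ι → ℝ≥0∞) :
    expNeg (∑ i ∈ s, f i) = ∏ i ∈ s, expNeg (f i) := by
  classical
  induction s using Finset.induction_on with
  | empty => simp
  | insert a s ha ih => rw [Finset.sum_insert ha, Finset.prod_insert ha, expNeg_add, ih]

/-- Continuity on all of [0, ∞] carries partial sums to partial products. A divergent series is
included: its product is 0. -/
lemma expNeg_tsum {ι : Type*} (f : ι → ℝ≥0∞) :
    HasProd (fun i => expNeg (f i)) (expNeg (∑' i, f i)) := by
  have h := (continuous_expNeg.tendsto _).comp (ENNReal.summable (f := f)).hasSum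
  refine h.congr fun s => ?_
  simp [expNeg_sum]

lemma expNeg_ofReal {r : ℝ} (hr : 0 ≤ r) :
    expNeg (ENNReal.ofReal r) = ENNReal.ofReal (Real.exp (-r)) := by
  rw [expNeg, EReal.coe_ennreal_ofReal, max_eq_left hr, ← EReal.coe_neg, EReal.exp_coe]

lemma expNeg_mul_natCast (c : ℝ≥0∞) (n : ℕ) : expNeg (c * n) = expNeg c ^ n := by
  have := expNeg_sum (Finset.range n) fun _ => c
  simpa [mul_comm] using this

/-- The inverse of `expNeg` on `[0, 1]`. -/
def negLog (t : ℝ≥0∞) : ℝ≥0∞ := (-ENNReal.log t).toENNReal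

@[fun_prop]
lemma measurable_negLog : Measurable negLog :=
  measurable_ereal_toENNReal.comp (measurable_neg.comp ENNReal.measurable_log)

/-- Lets any [0, 1]-valued factor, 0 included, enter the Laplace functional as some exp(-g). -/
lemma expNeg_negLog {t : ℝ≥0∞} (ht : t ≤ 1) : expNeg (negLog t) = t := by
  have h : 0 ≤ -ENNReal.log t := by
    have := ENNReal.log_le_zero_iff.2 ht
    rwa [EReal.le_neg, neg_zero]
  rw [expNeg, negLog, EReal.coe_toENNReal h, neg_neg, ENNReal.exp_log]

lemma lintegral_expNeg_poissonMeasure (r : ℝ≥0) (c : ℝ≥0∞) :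
    ∫⁻ n, expNeg (c * n) ∂(poissonMeasure r) = expNeg (r * (1 - expNeg c)) := by
  have hq : expNeg c ≠ ∞ := ((expNeg_le_one c).trans_lt ENNReal.one_lt_top).ne
  obtain ⟨q, hq'⟩ : ∃ q : ℝ≥0, expNeg c = q := ⟨_, (ENNReal.coe_toNNReal hq).symm⟩
  have hq1 : q ≤ 1 := by exact_mod_cast hq' ▸ expNeg_le_one c
  have hs : HasSum (fun n : ℕ => Real.exp (-r) * (r * q) ^ n / n.factorial)
      (Real.exp (-(r * (1 - q) : ℝ))) := by
    convert! (NormedSpace.expSeries_div_hasSum_exp ((r * q : ℝ))).mul_left (Real.exp (-r)) using 1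
    · simp_rw [mul_div_assoc]
    · rw [← Real.exp_eq_exp_ℝ, ← Real.exp_add]; ring_nf
  rw [poissonMeasure, lintegral_sum_measure]
  simp only [lintegral_smul_measure, lintegral_dirac, expNeg_mul_natCast, hq', smul_eq_mul]
  have e1 : (r : ℝ≥0∞) * (1 - (q : ℝ≥0∞)) = ENNReal.ofReal ((r : ℝ) * (1 - q)) := by
    rw [ENNReal.ofReal_mul r.coe_nonneg, ENNReal.ofReal_sub _ q.coe_nonneg]
    simp
  rw [e1, expNeg_ofReal (mul_nonneg r.coe_nonneg (sub_nonneg.2 (by exact_mod_cast hq1))), ← hs.tsum_eq,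
    ENNReal.ofReal_tsum_of_nonneg (fun n => by positivity) hs.summable]
  refine tsum_congr fun n => ?_
  have : (q : ℝ≥0∞) ^ n = ENNReal.ofReal (q ^ n) := by
    rw [ENNReal.ofReal_pow q.coe_nonneg, ENNReal.ofReal_coe_nnreal]
  rw [this, ← ENNReal.ofReal_mul (by positivity), mul_pow]
  congr 1; ring

lemma lintegral_natCast_poissonMeasure (r : ℝ≥0) :
    ∫⁻ n, (n : ℝ≥0∞) ∂(poissonMeasure r) = r := by
  have hs : HasSum (fun n : ℕ => Real.exp (-r) * r ^ n / n.factorial * n) (r : ℝ) := by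
    -- The term n = 0 vanishes; after the shift, n / n! cancels to leave r times the Poisson
    -- weights.
    rw [← hasSum_nat_add_iff' 1]
    simp only [Finset.range_one, Finset.sum_singleton, CharP.cast_eq_zero, mul_zero, sub_zero]
    convert! (hasSum_one_poissonMeasure r).mul_left (r : ℝ) using 1
    · ext n
      rw [Nat.factorial_succ]
      push_cast
      have : (n.factorial : ℝ) ≠ 0 := by positivity
      have : (n + 1 : ℝ) ≠ 0 := by positivity
      field_simp
      ring
    · simp
  rw [poissonMeasure, lintegral_sum_measure]
  simp only [lintegral_smul_measure, lintegral_dirac, smul_eq_mul]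
  refine Eq.trans ?_ (ENNReal.ofReal_coe_nnreal (p := r))
  conv_rhs => rw [← hs.tsum_eq]
  rw [
    ENNReal.ofReal_tsum_of_nonneg (fun n => by positivity) hs.summable]
  refine tsum_congr fun n => ?_
  rw [ENNReal.ofReal_mul (by positivity), ENNReal.ofReal_natCast]

/-! ### Laplace functional and intensity of the Poisson process -/

section Poisson

variable {Ω : Type*} [MeasurableSpace Ω] {μ : Measure Ω} {lam : ℝ≥0} {E : ℕ → Ω → Plane}

omit [MeasurableSpace Ω] in
lemma lintegral_pointCount (E : ℕ → Ω → Plane) (ω : Ω) (f : Plane → ℝ≥0∞) (hf : Measurable f) :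
    ∫⁻ x, f x ∂(pointCount E ω) = ∑' j, f (E j ω) := by
  simp [pointCount, lintegral_sum_measure, lintegral_dirac' _ hf]

lemma IsHomogeneousPPP.measurable_pointCount (hE : IsHomogeneousPPP μ lam E) {B : Set Plane}
    (hB : MeasurableSet B) : Measurable fun ω => pointCount E ω B := by
  simp only [pointCount, Measure.sum_apply _ hB, Measure.dirac_apply' _ hB]
  exact Measurable.tsum fun j => (measurable_one.indicator hB).comp (hE.measurable j)

lemma IsHomogeneousPPP.lintegral_comp_count (hE : IsHomogeneousPPP μ lam E) {B : Set Plane}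
    (hB : MeasurableSet B) (hB' : volume B ≠ ∞) {f : ℝ≥0∞ → ℝ≥0∞} (hf : Measurable f) :
    ∫⁻ ω, f (pointCount E ω B) ∂μ
      = ∫⁻ n, f (n : ℝ≥0∞) ∂(poissonMeasure (lam * (volume B).toNNReal)) := by
  rw [(hE.hasLaw_count B hB hB').lintegral_comp hf.aemeasurable,
    lintegral_map hf (measurable_of_countable _)]

lemma IsHomogeneousPPP.lintegral_expNeg_count (hE : IsHomogeneousPPP μ lam E) {B : Set Plane}
    (hB : MeasurableSet B) (hB' : volume B ≠ ∞) (c : ℝ≥0∞) :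
    ∫⁻ ω, expNeg (c * pointCount E ω B) ∂μ = expNeg (lam * ((1 - expNeg c) * volume B)) := by
  rw [hE.lintegral_comp_count hB hB' (f := fun a => expNeg (c * a)) (by fun_prop),
    lintegral_expNeg_poissonMeasure]
  rw [ENNReal.coe_mul, ENNReal.coe_toNNReal hB', mul_assoc, mul_comm (volume B)]

/-- The Laplace functional of a Poisson process at a simple function of bounded support. -/
lemma IsHomogeneousPPP.lintegral_expNeg_simpleFunc [IsProbabilityMeasure μ]
    (hE : IsHomogeneousPPP μ lam E) (g : SimpleFunc Plane ℝ≥0∞)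
    (hg : ∀ y, y ≠ 0 → volume (g ⁻¹' {y}) ≠ ∞) :
    ∫⁻ ω, expNeg (∫⁻ x, g x ∂(pointCount E ω)) ∂μ
      = expNeg (lam * ∫⁻ x, (1 - expNeg (g x))) := by
  -- Independence of counts is available for `Fin`-indexed families, so the level sets of `g` are
  -- numbered.
  let e := g.range.equivFin
  have hind := hE.indep_count g.range.card (fun i => g ⁻¹' {((e.symm i : g.range) : ℝ≥0∞)})
    (fun i => g.measurableSet_preimage _) (by
      intro i j hij
      refine Disjoint.preimage _ (Set.disjoint_singleton.2 fun h => hij ?_)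
      exact e.symm.injective (Subtype.ext h))
  have hind2 := hind.comp (fun i a => expNeg (((e.symm i : g.range) : ℝ≥0∞) * a))
    (fun i => by fun_prop)
  have key := lintegral_prod_eq_prod_lintegral_of_indepFun Finset.univ _ hind2 (fun i => by
    have := hE.measurable_pointCount (g.measurableSet_preimage {((e.symm i : g.range) : ℝ≥0∞)})
    simp only [Function.comp_def]
    fun_prop)
  simp only [Function.comp_def] at key
  have hL : ∀ ω, expNeg (∫⁻ x, g x ∂(pointCount E ω)) = ∏ i, expNeg
      (((e.symm i : g.range) : ℝ≥0∞) * pointCount E ω (g ⁻¹' {((e.symm i : g.range) : ℝ≥0∞)})) := by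
    intro ω
    rw [SimpleFunc.lintegral_eq_lintegral, SimpleFunc.lintegral, expNeg_sum,
      ← Finset.prod_coe_sort, ← e.symm.prod_comp]
  have hR : expNeg (lam * ∫⁻ x, (1 - expNeg (g x))) = ∏ i, expNeg (lam *
      ((1 - expNeg ((e.symm i : g.range) : ℝ≥0∞)) *
        volume (g ⁻¹' {((e.symm i : g.range) : ℝ≥0∞)}))) := by
    have : ∫⁻ x, (1 - expNeg (g x)) = (g.map fun y => 1 - expNeg y).lintegral volume := by
      rw [← SimpleFunc.lintegral_eq_lintegral]; rfl
    rw [this, SimpleFunc.map_lintegral, Finset.mul_sum, expNeg_sum, ← Finset.prod_coe_sort,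
      ← e.symm.prod_comp]
  simp only [hL]
  rw [hR, key]
  refine Finset.prod_congr rfl fun i _ => ?_
  -- The level set of 0 may have infinite area, but there both sides are 1.
  by_cases h0 : ((e.symm i : g.range) : ℝ≥0∞) = 0
  · simp [h0]
  · exact hE.lintegral_expNeg_count (g.measurableSet_preimage _) (hg _ h0) _

/-- The Laplace functional of a homogeneous Poisson process. -/
theorem IsHomogeneousPPP.lintegral_expNeg_tsum [IsProbabilityMeasure μ]
    (hE : IsHomogeneousPPP μ lam E) {g : Plane → ℝ≥0∞} (hg : Measurable g) :
    ∫⁻ ω, expNeg (∑' j, g (E j ω)) ∂μ = expNeg (lam * ∫⁻ x, (1 - expNeg (g x))) := by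
  -- Cutting off to balls gives the nonzero levels finite area, while the approximation still
  -- increases to `g`.
  let φ : ℕ → SimpleFunc Plane ℝ≥0∞ := fun n =>
    (SimpleFunc.eapprox g n).restrict (Metric.ball 0 n)
  have hφ : ∀ n x, φ n x = (Metric.ball (0 : Plane) n).indicator (SimpleFunc.eapprox g n) x :=
    fun n x => SimpleFunc.restrict_apply _ measurableSet_ball x
  have hmono : ∀ x, Monotone fun n => φ n x := by
    intro x m n hmn
    simp only [hφ]
    refine (Set.indicator_le_indicator (SimpleFunc.monotone_eapprox g hmn x)).trans ?_
    exact Set.indicator_le_indicator_of_subset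
      (Metric.ball_subset_ball (by exact_mod_cast hmn)) (fun _ => zero_le) x
  have hlim : ∀ x, Tendsto (fun n => φ n x) atTop (𝓝 (g x)) := by
    intro x
    refine (SimpleFunc.tendsto_eapprox hg x).congr' ?_
    obtain ⟨n, hn⟩ := exists_nat_gt ‖x‖
    filter_upwards [eventually_ge_atTop n] with m hm
    rw [hφ, Set.indicator_of_mem]
    simpa using hn.trans_le (by exact_mod_cast hm)
  have hfin : ∀ n, ∀ y, y ≠ 0 → volume (φ n ⁻¹' {y}) ≠ ∞ := by
    intro n y hy
    rw [SimpleFunc.restrict_preimage_singleton _ measurableSet_ball hy]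
    exact ((measure_mono Set.inter_subset_left).trans_lt measure_ball_lt_top).ne
  have key := fun n => hE.lintegral_expNeg_simpleFunc (φ n) (hfin n)
  have hsum : ∀ (f : Plane → ℝ≥0∞), Measurable f → Measurable fun ω => ∑' j, f (E j ω) :=
    fun f hf => Measurable.tsum fun j => hf.comp (hE.measurable j)
  have h1 : Tendsto (fun n => ∫⁻ ω, expNeg (∫⁻ x, φ n x ∂(pointCount E ω)) ∂μ) atTop
      (𝓝 (∫⁻ ω, expNeg (∑' j, g (E j ω)) ∂μ)) := by
    refine tendsto_lintegral_of_dominated_convergence (fun _ => 1) (fun n => ?_)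
      (fun n => ae_of_all _ fun ω => expNeg_le_one _) (by simp) (ae_of_all _ fun ω => ?_)
    · simp only [lintegral_pointCount E _ _ (φ n).measurable]
      exact measurable_expNeg.comp (hsum _ (φ n).measurable)
    · refine (continuous_expNeg.tendsto _).comp ?_
      rw [← lintegral_pointCount E ω g hg]
      exact lintegral_tendsto_of_tendsto_of_monotone (fun n => (φ n).measurable.aemeasurable)
        (ae_of_all _ hmono) (ae_of_all _ hlim)
  have h2 : Tendsto (fun n => expNeg (lam * ∫⁻ x, (1 - expNeg (φ n x)))) atTop
      (𝓝 (expNeg (lam * ∫⁻ x, (1 - expNeg (g x))))) := by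
    refine (continuous_expNeg.tendsto _).comp (ENNReal.Tendsto.const_mul ?_ (Or.inr (by simp)))
    refine lintegral_tendsto_of_tendsto_of_monotone (fun n => ?_) (ae_of_all _ fun x m n hmn => ?_)
      (ae_of_all _ fun x => ?_)
    · exact (measurable_const.sub (measurable_expNeg.comp (φ n).measurable)).aemeasurable
    · exact tsub_le_tsub_left (antitone_expNeg (hmono x hmn)) _
    · exact ENNReal.Tendsto.sub tendsto_const_nhds ((continuous_expNeg.tendsto _).comp (hlim x))
        (Or.inl (by simp))
  exact tendsto_nhds_unique h1 (h2.congr fun n => (key n).symm)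

/-- The mean of the Poisson count settles sets of finite area; exhaustion by balls gives the rest.
-/
lemma IsHomogeneousPPP.sum_map_eq (hE : IsHomogeneousPPP μ lam E) :
    Measure.sum (fun j => μ.map (E j)) = (lam : ℝ≥0∞) • (volume : Measure Plane) := by
  have hfin : ∀ B : Set Plane, MeasurableSet B → volume B ≠ ∞ →
      Measure.sum (fun j => μ.map (E j)) B = ((lam : ℝ≥0∞) • (volume : Measure Plane)) B := by
    intro B hB hB'
    have h1 := hE.lintegral_comp_count hB hB' measurable_id
    simp only [id, lintegral_natCast_poissonMeasure, ENNReal.coe_mul,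
      ENNReal.coe_toNNReal hB'] at h1
    rw [Measure.smul_apply, smul_eq_mul, ← h1, Measure.sum_apply _ hB]
    simp only [pointCount, Measure.sum_apply _ hB, Measure.dirac_apply' _ hB]
    rw [lintegral_tsum (f := fun j ω => B.indicator 1 (E j ω)) fun j => ((measurable_one.indicator hB).comp (hE.measurable j)).aemeasurable]
    refine tsum_congr fun j => ?_
    rw [Measure.map_apply (hE.measurable j) hB, ← lintegral_indicator_one (hE.measurable j hB)]
    rfl
  refine Measure.ext fun B hB => ?_
  have hU : B = ⋃ n : ℕ, B ∩ Metric.ball 0 n := by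
    rw [← Set.inter_iUnion, Metric.iUnion_ball_nat, Set.inter_univ]
  have hm : Monotone fun n : ℕ => B ∩ Metric.ball (0 : Plane) n := fun m n hmn =>
    Set.inter_subset_inter_right _ (Metric.ball_subset_ball (by exact_mod_cast hmn))
  rw [hU, hm.measure_iUnion, hm.measure_iUnion]
  exact iSup_congr fun n => hfin _ (hB.inter measurableSet_ball)
    ((measure_mono Set.inter_subset_right).trans_lt measure_ball_lt_top).ne

/-- Campbell's formula for a homogeneous Poisson process. -/
lemma IsHomogeneousPPP.tsum_lintegral (hE : IsHomogeneousPPP μ lam E) {f : Plane → ℝ≥0∞}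
    (hf : Measurable f) : ∑' j, ∫⁻ ω, f (E j ω) ∂μ = lam * ∫⁻ x, f x := by
  rw [← smul_eq_mul, ← lintegral_smul_measure, ← hE.sum_map_eq, lintegral_sum_measure]
  exact tsum_congr fun j => (lintegral_map hf (hE.measurable j)).symm

/-- The law of each point is one summand of the intensity, so it charges no Lebesgue-null set. -/
lemma IsHomogeneousPPP.ae_forall (hE : IsHomogeneousPPP μ lam E) {q : Plane → Prop}
    (hq : ∀ᵐ x, q x) : ∀ᵐ ω ∂μ, ∀ j, q (E j ω) := by
  refine ae_all_iff.2 fun j => ?_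
  have h : ∀ᵐ x ∂(Measure.sum fun j => μ.map (E j)), q x := by
    rw [hE.sum_map_eq]; exact Measure.ae_smul_measure hq _
  exact ae_of_ae_map (hE.measurable j).aemeasurable (Measure.ae_sum_iff.1 h j)

end Poisson

/-! ### Sums of independent exponential variables -/

section Exponential

lemma expMeasure_absolutelyContinuous (r : ℝ) : expMeasure r ≪ volume :=
  withDensity_absolutelyContinuous _ _

lemma expMeasure_real_Iic {r : ℝ} (hr : 0 < r) {t : ℝ} (ht : 0 ≤ t) :
    (expMeasure r).real (Set.Iic t) = 1 - Real.exp (-(r * t)) := by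
  have := isProbabilityMeasure_expMeasure hr
  rw [← cdf_eq_real, cdf_expMeasure_eq hr, if_pos ht]

lemma expMeasure_real_Ici {r : ℝ} (hr : 0 < r) {t : ℝ} (ht : 0 ≤ t) :
    (expMeasure r).real (Set.Ici t) = Real.exp (-(r * t)) := by
  have := isProbabilityMeasure_expMeasure hr
  have h1 : (Set.Ici t : Set ℝ) =ᵐ[expMeasure r] Set.Ioi t :=
    (expMeasure_absolutelyContinuous r).ae_eq (Ioi_ae_eq_Ici (μ := volume)).symm
  rw [measureReal_congr h1, ← Set.compl_Iic, probReal_compl_eq_one_sub measurableSet_Iic,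
    expMeasure_real_Iic hr ht]
  ring

lemma ae_pos_expMeasure {r : ℝ} (hr : 0 < r) : ∀ᵐ u ∂(expMeasure r), 0 < u := by
  have := isProbabilityMeasure_expMeasure hr
  have h := expMeasure_real_Iic hr le_rfl
  simp only [mul_zero, neg_zero, Real.exp_zero, sub_self] at h
  rw [measureReal_eq_zero_iff] at h
  rw [ae_iff]
  convert h using 2
  ext; simp

lemma expMeasure_map_div {r : ℝ} (hr : 0 < r) :
    (expMeasure 1).map (fun u => u / r) = expMeasure r := by
  have := isProbabilityMeasure_expMeasure hr
  have := isProbabilityMeasure_expMeasure one_pos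
  have : IsProbabilityMeasure ((expMeasure 1).map (fun u => u / r)) :=
    Measure.isProbabilityMeasure_map (by fun_prop)
  refine Measure.eq_of_cdf _ _ ?_
  ext t
  rw [cdf_eq_real, map_measureReal_apply (by fun_prop) measurableSet_Iic]
  have : (fun u => u / r) ⁻¹' Set.Iic t = Set.Iic (r * t) := by
    ext u; simp [div_le_iff₀ hr, mul_comm]
  rw [this, ← cdf_eq_real, cdf_expMeasure_eq one_pos, cdf_expMeasure_eq hr]
  simp [mul_nonneg_iff_of_pos_left hr]

lemma setIntegral_Ioo_expMeasure {r : ℝ} (hr : 0 < r) {t : ℝ} (ht : 0 ≤ t) (f : ℝ → ℝ) :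
    ∫ u in Set.Ioo 0 t, f u ∂(expMeasure r)
      = ∫ u in (0 : ℝ)..t, r * Real.exp (-(r * u)) * f u := by
  rw [intervalIntegral.integral_of_le ht, ← integral_Ioc_eq_integral_Ioo' , expMeasure, gammaMeasure]
  unfold gammaPDF
  rw [setIntegral_withDensity_eq_setIntegral_toReal_smul (measurable_gammaPDFReal 1 r).ennreal_ofReal
      (ae_of_all _ fun _ => ENNReal.ofReal_lt_top) _ measurableSet_Ioc]
  · refine setIntegral_congr_fun measurableSet_Ioc fun u hu => ?_
    have := exponentialPDF_of_nonneg (r := r) hu.1.le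
    rw [exponentialPDF, exponentialPDFReal] at this
    simp only [smul_eq_mul]
    rw [this, ENNReal.toReal_ofReal (by positivity)]
  · exact expMeasure_absolutelyContinuous r (by simp)

/-- The convolution that adds one exponential variable of rate `r` to a tail term of rate `q`;
distinct rates give an elementary antiderivative. -/
lemma intervalIntegral_exp_mul_exp {r q : ℝ} (hrq : r ≠ q) (t : ℝ) :
    ∫ u in (0 : ℝ)..t, r * Real.exp (-(r * u)) * Real.exp (-(q * (t - u)))
      = r / (r - q) * (Real.exp (-(q * t)) - Real.exp (-(r * t))) := by
  have hd : ∀ u ∈ Set.uIcc 0 t, HasDerivAt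
      (fun u => -(r / (r - q)) * (Real.exp (-(r * u)) * Real.exp (-(q * (t - u)))))
      (r * Real.exp (-(r * u)) * Real.exp (-(q * (t - u)))) u := by
    intro u _
    have h1 : HasDerivAt (fun u => -(r * u)) (-r) u := by
      convert! ((hasDerivAt_id u).const_mul r).neg using 1; simp
    have h2 : HasDerivAt (fun u => -(q * (t - u))) q u := by
      convert! (((hasDerivAt_id u).const_sub t).const_mul q).neg using 1; simp
    convert! (h1.exp.mul h2.exp).const_mul (-(r / (r - q))) using 1
    have : r - q ≠ 0 := sub_ne_zero.2 hrq
    field_simp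
    ring
  rw [intervalIntegral.integral_eq_sub_of_hasDerivAt hd
    (Continuous.intervalIntegrable (by fun_prop) _ _)]
  simp
  ring

/-- The coefficients of the partial fraction expansion sum to one. -/
lemma sum_prod_div_sub_eq_one {ι : Type*} [DecidableEq ι] {s : Finset ι} (hs : s.Nonempty)
    {r : ι → ℝ} (hr : Set.InjOn r s) :
    ∑ k ∈ s, ∏ m ∈ s.erase k, r m / (r m - r k) = 1 := by
  -- The coefficients are the values at 0 of the Lagrange basis polynomials with nodes `r`, and
  -- these polynomials sum to 1.
  have h := congrArg (Polynomial.eval 0) (Lagrange.sum_basis hr hs)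
  rw [Polynomial.eval_finsetSum, Polynomial.eval_one] at h
  rw [← h]
  refine Finset.sum_congr rfl fun k _ => ?_
  rw [Lagrange.basis, Polynomial.eval_prod]
  refine Finset.prod_congr rfl fun m _ => ?_
  simp only [Lagrange.basisDivisor, Polynomial.eval_mul, Polynomial.eval_C, Polynomial.eval_sub,
    Polynomial.eval_X]
  rw [← neg_sub (r k) (r m), div_neg, zero_sub, mul_neg, div_eq_inv_mul]

/-- The tail of a sum of independent exponential variables with distinct rates. -/
theorem measureReal_le_sum_of_iIndepFun_exp {Ω ι : Type*} [MeasurableSpace Ω] [DecidableEq ι]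
    {P : Measure Ω} [IsProbabilityMeasure P] {X : ι → Ω → ℝ} (hX : ∀ i, Measurable (X i))
    {r : ι → ℝ} (hr : ∀ i, 0 < r i) (hlaw : ∀ i, P.map (X i) = expMeasure (r i))
    (hind : iIndepFun X P) (s : Finset ι) (hs : Set.InjOn r s) {t : ℝ} (ht : 0 < t) :
    P.real {ω | t ≤ ∑ i ∈ s, X i ω}
      = ∑ k ∈ s, (∏ m ∈ s.erase k, r m / (r m - r k)) * Real.exp (-(r k * t)) := by
  -- The level must vary: conditioning on X_a = u calls for the tail at t - u. The empty sum is
  -- covered because t > 0.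
  induction s using Finset.induction_on generalizing t with
  | empty => simp [ht.not_ge]
  | insert a s ha ih =>
    have hs' : Set.InjOn r s := hs.mono (by simp)
    have hne : ∀ k ∈ s, r a ≠ r k := fun k hk h =>
      ha (hs (by simp) (by simp [hk]) h ▸ hk)
    have := isProbabilityMeasure_expMeasure (hr a)
    set Y : Ω → ℝ := fun ω => ∑ i ∈ s, X i ω with hY
    have hYm : Measurable Y := by fun_prop
    have hYpos : ∀ᵐ ω ∂P, 0 ≤ Y ω := by
      have : ∀ i, ∀ᵐ ω ∂P, 0 < X i ω := fun i => by
        have h := ae_pos_expMeasure (hr i)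
        rw [← hlaw i] at h
        exact ae_of_ae_map (hX i).aemeasurable h
      filter_upwards [(Finset.eventually_all s).2 fun i _ => this i] with ω hω
      exact Finset.sum_nonneg fun i hi => (hω i hi).le
    have hXY : IndepFun (X a) Y P := by
      have := (hind.indepFun_finsetSum_of_notMem hX ha).symm
      convert this using 1
      ext ω; simp [hY]
    have hpair : P.map (fun ω => (X a ω, Y ω)) = (expMeasure (r a)).prod (P.map Y) := by
      rw [(indepFun_iff_map_prod_eq_prod_map_map (hX a).aemeasurable hYm.aemeasurable).1 hXY,
        hlaw a]
    have : IsProbabilityMeasure (P.map Y) := Measure.isProbabilityMeasure_map hYm.aemeasurable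
    have hset : MeasurableSet {z : ℝ × ℝ | t ≤ z.1 + z.2} :=
      measurableSet_le measurable_const (by fun_prop)
    have hT : P.real {ω | t ≤ ∑ i ∈ insert a s, X i ω}
        = ∫ u, P.real {ω | t - u ≤ Y ω} ∂(expMeasure (r a)) := by
      have e1 : {ω | t ≤ ∑ i ∈ insert a s, X i ω}
          = (fun ω => (X a ω, Y ω)) ⁻¹' {z : ℝ × ℝ | t ≤ z.1 + z.2} := by
        ext ω; simp [Finset.sum_insert ha, hY]
      rw [e1, ← map_measureReal_apply (by fun_prop) hset, hpair, measureReal_def,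
        Measure.prod_apply hset, ← integral_toReal
          (measurable_measure_prodMk_left hset).aemeasurable (ae_of_all _ fun u => measure_lt_top _ _)]
      refine integral_congr_ae (ae_of_all _ fun u => ?_)
      simp only [measureReal_def]
      rw [Measure.map_apply hYm (measurable_prodMk_left hset)]
      congr 2
      ext ω; simp [add_comm]
    set H : ℝ → ℝ := fun u => ∑ k ∈ s, (∏ m ∈ s.erase k, r m / (r m - r k)) *
      Real.exp (-(r k * (t - u))) with hH
    have hHc : Continuous H := by fun_prop
    -- For u < t the induction hypothesis applies at t - u > 0. For u ≥ t the event is almost sure,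
    -- since Y ≥ 0.
    have hG : (fun u => P.real {ω | t - u ≤ Y ω}) =ᵐ[expMeasure (r a)]
        fun u => (Set.Ioo 0 t).indicator H u + (Set.Ici t).indicator (1 : ℝ → ℝ) u := by
      filter_upwards [ae_pos_expMeasure (hr a)] with u hu
      rcases lt_or_ge u t with h | h
      · rw [Set.indicator_of_mem (show u ∈ Set.Ioo 0 t from ⟨hu, h⟩),
          Set.indicator_of_notMem (by simpa using h), add_zero, ih hs' (sub_pos.2 h)]
      · rw [Set.indicator_of_notMem (by simp [h]), Set.indicator_of_mem (by simpa using h), zero_add]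
        have : {ω | t - u ≤ Y ω} =ᵐ[P] Set.univ := by
          filter_upwards [hYpos] with ω hω
          exact eq_true (show t - u ≤ Y ω by linarith)
        rw [measureReal_congr this]; simp
    have hHi : IntegrableOn H (Set.Ioo 0 t) (expMeasure (r a)) :=
      (hHc.continuousOn.integrableOn_Icc (a := 0) (b := t)).mono_set Set.Ioo_subset_Icc_self
    have h1 : Integrable ((Set.Ici t).indicator (1 : ℝ → ℝ)) (expMeasure (r a)) :=
      (integrable_const (1 : ℝ)).indicator measurableSet_Ici
    rw [hT, integral_congr_ae hG,
      integral_add (hHi.integrable_indicator measurableSet_Ioo) h1,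
      integral_indicator measurableSet_Ioo, integral_indicator_one measurableSet_Ici,
      expMeasure_real_Ici (hr a) ht.le, setIntegral_Ioo_expMeasure (hr a) ht.le]
    have hI : ∫ u in (0 : ℝ)..t, r a * Real.exp (-(r a * u)) * H u
        = ∑ k ∈ s, (∏ m ∈ s.erase k, r m / (r m - r k)) *
          (r a / (r a - r k) * (Real.exp (-(r k * t)) - Real.exp (-(r a * t)))) := by
      simp only [hH, Finset.mul_sum]
      rw [intervalIntegral.integral_finsetSum fun k _ =>
        Continuous.intervalIntegrable (by fun_prop) _ _]
      refine Finset.sum_congr rfl fun k hk => ?_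
      rw [← intervalIntegral_exp_mul_exp (hne k hk), ← intervalIntegral.integral_const_mul]
      refine intervalIntegral.integral_congr fun u _ => ?_
      ring
    have herase : ∀ k ∈ s, ∏ m ∈ (insert a s).erase k, r m / (r m - r k)
        = r a / (r a - r k) * ∏ m ∈ s.erase k, r m / (r m - r k) := by
      intro k hk
      rw [Finset.erase_insert_of_ne (ne_of_mem_of_not_mem hk ha).symm, Finset.prod_insert (by simp [ha])]
    -- Supplies the coefficient of exp(-r_a t): the convolution yields 1 minus the other
    -- coefficients, which is the product for `a`.
    have hone := sum_prod_div_sub_eq_one (Finset.insert_nonempty a s) hs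
    rw [Finset.sum_insert ha, Finset.sum_congr rfl herase] at hone
    have herase' : ∀ k ∈ s,
        (∏ m ∈ (insert a s).erase k, r m / (r m - r k)) * Real.exp (-(r k * t))
          = r a / (r a - r k) * (∏ m ∈ s.erase k, r m / (r m - r k)) * Real.exp (-(r k * t)) :=
      fun k hk => by rw [herase k hk]
    rw [hI, Finset.sum_insert ha, eq_sub_of_add_eq hone, Finset.sum_congr rfl herase', sub_mul,
      Finset.sum_mul, one_mul]
    have : ∀ k ∈ s, (∏ m ∈ s.erase k, r m / (r m - r k)) *
          (r a / (r a - r k) * (Real.exp (-(r k * t)) - Real.exp (-(r a * t))))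
        = r a / (r a - r k) * (∏ m ∈ s.erase k, r m / (r m - r k)) * Real.exp (-(r k * t))
          - r a / (r a - r k) * (∏ m ∈ s.erase k, r m / (r m - r k)) * Real.exp (-(r a * t)) :=
      fun k _ => by ring
    rw [Finset.sum_congr rfl this, Finset.sum_sub_distrib]
    ring

end Exponential

/-! ### Almost everywhere distinct rates and the tail at a point of the plane -/

section Geometry

/-- An Apollonius circle is a null set. -/
lemma volume_setOf_mul_dist_sq_eq {P Q : Plane} (hPQ : P ≠ Q) {a b : ℝ} (ha : a ≠ 0) :
    volume {x : Plane | a * dist P x ^ 2 = b * dist Q x ^ 2} = 0 := by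
  by_cases hab : a = b
  · subst hab
    have : {x : Plane | a * dist P x ^ 2 = a * dist Q x ^ 2} = AffineSubspace.perpBisector P Q := by
      ext x
      rw [Set.mem_ofPred_eq, SetLike.mem_coe, AffineSubspace.mem_perpBisector_iff_dist_eq,
        mul_right_inj' ha, sq_eq_sq₀ dist_nonneg dist_nonneg, dist_comm x P, dist_comm x Q]
    rw [this]
    exact Measure.addHaar_affineSubspace _ _ (by simpa using hPQ)
  · have hab' : a - b ≠ 0 := sub_ne_zero.2 hab
    -- Centre and squared radius from completing the square.
    set C : Plane := (a - b)⁻¹ • (a • P - b • Q) with hC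
    set R : ℝ := ‖C‖ ^ 2 - (a - b)⁻¹ * (a * ‖P‖ ^ 2 - b * ‖Q‖ ^ 2) with hR
    refine measure_mono_null (fun x hx => ?_)
      (Measure.addHaar_sphere (volume : Measure Plane) C (Real.sqrt R))
    rw [Set.mem_ofPred_eq, dist_eq_norm, dist_eq_norm, norm_sub_sq_real, norm_sub_sq_real] at hx
    have h : ‖x - C‖ ^ 2 = R := by
      rw [norm_sub_sq_real, hR, hC, inner_smul_right, inner_sub_right, inner_smul_right,
        inner_smul_right, real_inner_comm P x, real_inner_comm Q x]
      field_simp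
      linear_combination hx
    -- No sign condition on `R` is needed: a point of the set forces `R` to be a square.
    rw [mem_sphere_iff_norm, ← h, Real.sqrt_sq (norm_nonneg _)]

/-- Polar coordinates reduce this to integrating y exp(-c y^α) over the half-line; the exponent `s
:= 1` is the dimension minus one. -/
lemma integrable_exp_neg_mul_dist_rpow (P : Plane) {c α : ℝ} (hc : 0 < c) (hα : 0 < α) :
    Integrable (fun x : Plane => Real.exp (-(c * dist P x ^ α))) := by
  have h : Integrable (fun x : Plane => Real.exp (-c * ‖x‖ ^ α)) := by
    rw [integrable_fun_norm_addHaar (volume : Measure Plane)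
      (f := fun y : ℝ => Real.exp (-c * y ^ α))]
    have := integrableOn_rpow_mul_exp_neg_mul_rpow (s := 1) (by norm_num) hα hc
    simpa using this
  have h2 := h.comp_sub_right P
  refine h2.congr (ae_of_all _ fun x => ?_)
  simp [dist_eq_norm, norm_sub_rev]

variable {N : ℕ} {A : Fin (N + 1) → Plane} {p : Fin N → ℝ} {α : ℝ}

lemma rate_pos (hp : ∀ i, 0 < p i) {k : Fin N} {x : Plane} (hx : A k.castSucc ≠ x) :
    0 < rate A p α k x :=
  mul_pos (inv_pos.2 (hp k)) (Real.rpow_pos_of_pos (dist_pos.2 hx) _)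

/-- Raising λ_k = λ_m to the power 2/α gives a weighted equality of squared distances to two
distinct points, which is an Apollonius circle or a bisector. -/
lemma ae_rate_injective (hA : Function.Injective A) (hp : ∀ i, 0 < p i) (hα : 0 < α) :
    ∀ᵐ x, Function.Injective fun k => rate A p α k x := by
  have h : ∀ k m : Fin N, ∀ᵐ x, k ≠ m → rate A p α k x ≠ rate A p α m x := by
    intro k m
    by_cases hkm : k = m
    · simp [hkm]
    have hpow : ∀ (i : Fin N) x, rate A p α i x ^ (2 / α)
        = (p i)⁻¹ ^ (2 / α) * dist (A i.castSucc) x ^ 2 := by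
      intro i x
      rw [rate, Real.mul_rpow (inv_nonneg.2 (hp i).le) (by positivity), ← Real.rpow_mul dist_nonneg,
        mul_div_cancel₀ _ hα.ne', Real.rpow_two]
    have hne : A k.castSucc ≠ A m.castSucc := fun h => hkm (Fin.castSucc_injective N (hA h))
    refine measure_mono_null (fun x hx => ?_) (volume_setOf_mul_dist_sq_eq hne
      (a := (p k)⁻¹ ^ (2 / α)) (b := (p m)⁻¹ ^ (2 / α))
      (Real.rpow_pos_of_pos (inv_pos.2 (hp k)) _).ne')
    simp only [Set.mem_compl_iff, Set.mem_ofPred_eq, ne_eq, not_forall, not_not] at hx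
    rw [Set.mem_ofPred_eq, ← hpow, ← hpow, hx.2]
  filter_upwards [ae_all_iff.2 fun k => ae_all_iff.2 (h k)] with x hx k m hkm
  by_contra hne
  exact hx k m hne hkm

lemma ae_forall_ne (A : Fin (N + 1) → Plane) : ∀ᵐ x, ∀ k : Fin N, A k.castSucc ≠ x :=
  ae_all_iff.2 fun k => by
    filter_upwards [Measure.ae_ne volume (A k.castSucc)] with x hx using hx.symm

/-- The combined SNR of an eavesdropper at `x` whose channels have the power gains `u`. -/
def combinedSNR (A : Fin (N + 1) → Plane) (p : Fin N → ℝ) (α : ℝ) (x : Plane) (u : Fin N → ℝ) :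
    ℝ :=
  ∑ k, p k * u k / dist (A k.castSucc) x ^ α

@[fun_prop]
lemma measurable_combinedSNR {β : Type*} [MeasurableSpace β] {f : β → Plane} {g : β → Fin N → ℝ}
    (hf : Measurable f) (hg : Measurable g) :
    Measurable fun b => combinedSNR A p α (f b) (g b) := by
  unfold combinedSNR
  fun_prop

lemma combinedSNR_eq_sum_div_rate (x : Plane) (u : Fin N → ℝ) :
    combinedSNR A p α x u = ∑ k, u k / rate A p α k x := by
  refine Finset.sum_congr rfl fun k _ => ?_
  rw [rate, div_mul_eq_div_div, div_inv_eq_mul, mul_comm (u k)]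

/-- The law of `N` independent exponential power gains. -/
def gainLaw (N : ℕ) : Measure (Fin N → ℝ) := Measure.pi fun _ => expMeasure 1

instance : IsProbabilityMeasure (expMeasure 1) := isProbabilityMeasure_expMeasure one_pos

instance : IsProbabilityMeasure (gainLaw N) := by unfold gainLaw; infer_instance

/-- The probability that the combined SNR of an eavesdropper at `x` is at least `s`. -/
def snrTail (A : Fin (N + 1) → Plane) (p : Fin N → ℝ) (α : ℝ) (s : ℝ) (x : Plane) : ℝ≥0∞ :=
  gainLaw N {u | s ≤ combinedSNR A p α x u}

lemma measurable_snrTail (s : ℝ) : Measurable (snrTail A p α s) :=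
  measurable_measure_prodMk_left (measurableSet_le measurable_const
    (measurable_combinedSNR measurable_fst measurable_snd :
      Measurable fun z : Plane × (Fin N → ℝ) => combinedSNR A p α z.1 z.2))

lemma gainLaw_map_div_rate (hp : ∀ i, 0 < p i) {x : Plane} (hx : ∀ k : Fin N, A k.castSucc ≠ x)
    (k : Fin N) :
    (gainLaw N).map (fun u => u k / rate A p α k x) = expMeasure (rate A p α k x) := by
  rw [← expMeasure_map_div (rate_pos hp (hx k))]
  have : (gainLaw N).map (Function.eval k) = expMeasure 1 := by
    rw [gainLaw, Measure.pi_map_eval]; simp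
  rw [← this, Measure.map_map (by fun_prop) (by fun_prop)]
  rfl

lemma ae_toReal_snrTail (hA : Function.Injective A) (hp : ∀ i, 0 < p i) (hα : 0 < α) {s : ℝ}
    (hs : 0 < s) : (fun x => (snrTail A p α s x).toReal) =ᵐ[volume] integrand A p α s := by
  filter_upwards [ae_rate_injective hA hp hα, ae_forall_ne A] with x hinj hx
  have hind : iIndepFun (fun (k : Fin N) (u : Fin N → ℝ) => u k / rate A p α k x) (gainLaw N) :=
    iIndepFun_pi (μ := fun _ => expMeasure 1) (X := fun k u => u / rate A p α k x)
      fun k => by fun_prop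
  have h := measureReal_le_sum_of_iIndepFun_exp (fun k => by fun_prop)
    (fun k => rate_pos hp (hx k)) (gainLaw_map_div_rate hp hx) hind Finset.univ
    hinj.injOn hs
  simp only [snrTail, combinedSNR_eq_sum_div_rate]
  refine h.trans (Finset.sum_congr rfl fun k _ => ?_)
  rw [delta, rate, mul_comm (p k)⁻¹]

/-- If N terms sum to at least s, one of them is at least s/N. The union bound then leaves N
integrable functions exp(-c d^α). -/
lemma lintegral_snrTail_ne_top (hN : 1 ≤ N) (hp : ∀ i, 0 < p i) (hα : 0 < α) {s : ℝ}
    (hs : 0 < s) : ∫⁻ x, snrTail A p α s x ≠ ∞ := by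
  have hN' : (0 : ℝ) < N := by exact_mod_cast hN
  have hne : (Finset.univ : Finset (Fin N)).Nonempty := ⟨⟨0, hN⟩, Finset.mem_univ _⟩
  have hle : ∀ᵐ x, snrTail A p α s x ≤ ∑ k : Fin N,
      ENNReal.ofReal (Real.exp (-((p k)⁻¹ * (s / N) * dist (A k.castSucc) x ^ α))) := by
    filter_upwards [ae_forall_ne A] with x hx
    have hsub : {u | s ≤ combinedSNR A p α x u}
        ⊆ ⋃ k, (fun u : Fin N → ℝ => u k / rate A p α k x) ⁻¹' Set.Ici (s / N) := by
      intro u hu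
      rw [Set.mem_ofPred_eq, combinedSNR_eq_sum_div_rate] at hu
      obtain ⟨k, -, hk⟩ := Finset.exists_le_of_sum_le hne (f := fun _ : Fin N => s / (N : ℝ))
        (g := fun k => u k / rate A p α k x) (by
          simpa [mul_div_cancel₀ _ hN'.ne'] using hu)
      exact Set.mem_iUnion.2 ⟨k, hk⟩
    refine (measure_mono hsub).trans ((measure_iUnion_le _).trans ?_)
    rw [tsum_fintype]
    refine Finset.sum_le_sum fun k _ => ?_
    rw [← Measure.map_apply (by fun_prop) measurableSet_Ici, gainLaw_map_div_rate hp hx]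
    have := isProbabilityMeasure_expMeasure (rate_pos (α := α) hp (hx k))
    rw [← ofReal_measureReal (measure_ne_top _ _),
      expMeasure_real_Ici (rate_pos hp (hx k)) (by positivity), rate]
    refine le_of_eq ?_
    congr 3; ring
  refine ((lintegral_mono_ae hle).trans_lt ?_).ne
  rw [lintegral_finsetSum _ fun k _ => by fun_prop]
  refine ENNReal.sum_lt_top.2 fun k _ => ?_
  have := hp k
  have hi := integrable_exp_neg_mul_dist_rpow (A k.castSucc)
    (c := (p k)⁻¹ * (s / N)) (by positivity) hα
  rw [← ofReal_integral_eq_lintegral_ofReal hi (ae_of_all _ fun x => by positivity)]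
  exact ENNReal.ofReal_lt_top

lemma integrable_integrand (hN : 1 ≤ N) (hA : Function.Injective A) (hp : ∀ i, 0 < p i)
    (hα : 0 < α) {s : ℝ} (hs : 0 < s) : Integrable (integrand A p α s) volume :=
  (integrable_toReal_of_lintegral_ne_top (measurable_snrTail s).aemeasurable
    (lintegral_snrTail_ne_top hN hp hα hs)).congr (ae_toReal_snrTail hA hp hα hs)

lemma expNeg_mul_lintegral_snrTail (hN : 1 ≤ N) (hA : Function.Injective A) (hp : ∀ i, 0 < p i)
    (hα : 0 < α) (lam : ℝ≥0) {s : ℝ} (hs : 0 < s) :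
    expNeg (lam * ∫⁻ x, snrTail A p α s x)
      = ENNReal.ofReal (Real.exp (-(lam : ℝ) * ∫ x, integrand A p α s x)) := by
  have hlt : ∀ᵐ x, snrTail A p α s x < ∞ := ae_of_all _ fun x => measure_lt_top _ _
  rw [← integral_congr_ae (ae_toReal_snrTail hA hp hα hs),
    integral_toReal (measurable_snrTail s).aemeasurable hlt, neg_mul, ← expNeg_ofReal (by positivity),
    ENNReal.ofReal_mul (by positivity), ENNReal.ofReal_coe_nnreal,
    ENNReal.ofReal_toReal (lintegral_snrTail_ne_top hN hp hα hs)]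

end Geometry

/-! ### Joint law of gains and locations -/

section JointLaw

lemma comap_comp_le_iSup_comap_eval {ι γ X : Type*} [MeasurableSpace X] (e : γ → ι) :
    (MeasurableSpace.pi : MeasurableSpace (γ → X)).comap (fun (x : ι → X) c => x (e c))
      ≤ ⨆ i ∈ Set.range e, (inferInstance : MeasurableSpace X).comap fun x : ι → X => x i := by
  rw [← measurable_iff_comap_le]
  refine @measurable_pi_lambda _ _ _ (_) _ _ fun c => ?_
  rw [measurable_iff_comap_le]
  exact le_iSup₂_of_le (e c) ⟨c, rfl⟩ le_rfl

/-- Disjoint blocks of independent coordinates generate independent σ-algebras; this separates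
legitimate from eavesdropping gains. -/
lemma indepFun_infinitePi_of_disjoint_range {ι α β X : Type*} [MeasurableSpace X]
    (P : ι → Measure X) [∀ i, IsProbabilityMeasure (P i)] {f : α → ι} {g : β → ι}
    (hfg : Disjoint (Set.range f) (Set.range g)) :
    IndepFun (fun (x : ι → X) a => x (f a)) (fun (x : ι → X) b => x (g b))
      (Measure.infinitePi P) := by
  have hind : iIndepFun (fun (i : ι) (x : ι → X) => x i) (Measure.infinitePi P) :=
    iIndepFun_infinitePi (X := fun _ x => x) fun _ => measurable_id
  rw [IndepFun_iff_Indep]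
  exact indep_of_indep_of_le_left (indep_of_indep_of_le_right
    (indep_iSup_of_disjoint (fun i => (measurable_pi_apply i).comap_le) hind.iIndep hfg)
    (comap_comp_le_iSup_comap_eval g)) (comap_comp_le_iSup_comap_eval f)

/-- The law of the power gains of the legitimate links and of the eavesdropping links, the latter
grouped by eavesdropper. -/
lemma infinitePi_map_gains (N : ℕ) :
    (Measure.infinitePi fun _ : Fin N ⊕ Fin N × ℕ => expMeasure 1).map
        (fun x => ((fun i => x (Sum.inl i)), fun (j : ℕ) (k : Fin N) => x (Sum.inr (k, j))))
      = (gainLaw N).prod (Measure.infinitePi fun _ : ℕ => gainLaw N) := by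
  have h1 : (Measure.infinitePi fun _ : Fin N ⊕ Fin N × ℕ => expMeasure 1).map
      (fun x i => x (Sum.inl i)) = gainLaw N := by
    rw [Measure.map_infinitePi_infinitePi_of_inj (f := Sum.inl) Sum.inl_injective,
      Measure.infinitePi_eq_pi, gainLaw]
  -- The pair is swapped to put the eavesdropper first, so that currying groups the gains by
  -- eavesdropper.
  have h2 : (Measure.infinitePi fun _ : Fin N ⊕ Fin N × ℕ => expMeasure 1).map
      (fun x (jk : ℕ × Fin N) => x (Sum.inr (jk.2, jk.1)))
        = Measure.infinitePi fun _ : ℕ × Fin N => expMeasure 1 :=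
    Measure.map_infinitePi_infinitePi_of_inj (f := fun jk : ℕ × Fin N => Sum.inr (jk.2, jk.1))
      fun a b hab => by
        rw [Sum.inr.injEq, Prod.mk.injEq] at hab
        exact Prod.ext hab.2 hab.1
  have hind := indepFun_infinitePi_of_disjoint_range
    (fun _ : Fin N ⊕ Fin N × ℕ => expMeasure 1) (f := Sum.inl)
    (g := fun jk : ℕ × Fin N => Sum.inr (jk.2, jk.1)) (by
      rw [Set.disjoint_iff_forall_ne]
      rintro _ ⟨a, rfl⟩ _ ⟨b, rfl⟩
      simp)
  have hprod := (indepFun_iff_map_prod_eq_prod_map_map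
    (Measurable.aemeasurable (by fun_prop)) (Measurable.aemeasurable (by fun_prop))).1 hind
  rw [h1, h2] at hprod
  have h3 := Measure.infinitePi_map_curry (fun (_ : ℕ) (_ : Fin N) => expMeasure 1)
  have h4 : (Measure.infinitePi fun _ : ℕ => gainLaw N)
      = (Measure.infinitePi fun _ : ℕ × Fin N => expMeasure 1).map
        (MeasurableEquiv.curry ℕ (Fin N) ℝ) := by
    rw [h3]
    simp only [gainLaw, Measure.infinitePi_eq_pi]
  rw [h4]
  conv_rhs => rw [← Measure.map_id (μ := gainLaw N)]
  rw [Measure.map_prod_map _ _ measurable_id (MeasurableEquiv.measurable _), ← hprod,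
    Measure.map_map (measurable_id.prodMap (MeasurableEquiv.measurable _)) (by fun_prop)]
  rfl

variable {Ω : Type*} [MeasurableSpace Ω] {μ : Measure Ω} [IsProbabilityMeasure μ] {N : ℕ}

/-- The joint law of the legitimate gains, the eavesdropping gains and the locations. -/
lemma hasLaw_gains_locations {E : ℕ → Ω → Plane} (hEm : ∀ j, Measurable (E j))
    {G : Fin N ⊕ Fin N × ℕ → Ω → ℝ} (hG : ∀ l, HasLaw (G l) (expMeasure 1) μ)
    (hind : iIndepFun G μ) (hGE : IndepFun (fun ω l => G l ω) (fun ω j => E j ω) μ) :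
    HasLaw (fun ω => ((fun i => G (Sum.inl i) ω),
        ((fun (j : ℕ) (k : Fin N) => G (Sum.inr (k, j)) ω), fun j => E j ω)))
      ((gainLaw N).prod ((Measure.infinitePi fun _ : ℕ => gainLaw N).prod
        (μ.map fun ω j => E j ω))) μ where
  aemeasurable := by
    have := fun l => (hG l).aemeasurable
    fun_prop
  map_eq := by
    have hGm : AEMeasurable (fun ω l => G l ω) μ :=
      aemeasurable_pi_iff.2 fun l => (hG l).aemeasurable
    have hEm' : Measurable (fun ω j => E j ω) := measurable_pi_lambda _ hEm
    have hjoint := (indepFun_iff_map_prod_eq_prod_map_map hGm hEm'.aemeasurable).1 hGE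
    rw [(hind.hasLaw_infinitePi hG hGm).map_eq] at hjoint
    have : IsProbabilityMeasure (μ.map fun ω j => E j ω) :=
      Measure.isProbabilityMeasure_map hEm'.aemeasurable
    have hψ : Measurable fun x : Fin N ⊕ Fin N × ℕ → ℝ =>
      ((fun i => x (Sum.inl i)), fun (j : ℕ) (k : Fin N) => x (Sum.inr (k, j))) := by fun_prop
    rw [← Measure.prodAssoc_prod, ← infinitePi_map_gains]
    conv_rhs => rw [← Measure.map_id (μ := μ.map fun ω j => E j ω)]
    rw [Measure.map_prod_map _ _ hψ measurable_id, ← hjoint,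
      Measure.map_map (MeasurableEquiv.measurable _) (hψ.prodMap measurable_id),
      AEMeasurable.map_map_of_aemeasurable
        ((MeasurableEquiv.measurable _).comp (hψ.prodMap measurable_id)).aemeasurable
        (hGm.prodMk hEm'.aemeasurable)]
    rfl

end JointLaw

/-! ### Outage of all eavesdroppers and existence of the maximum -/

section Eavesdropping

variable {Ω : Type*} [MeasurableSpace Ω] {μ : Measure Ω} [IsProbabilityMeasure μ] {lam : ℝ≥0}
  {E : ℕ → Ω → Plane} {N : ℕ} {A : Fin (N + 1) → Plane} {p : Fin N → ℝ} {α : ℝ}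

/-- The probability that every eavesdropper has a combined SNR below the level `s`. -/
lemma IsHomogeneousPPP.prod_setOf_forall_combinedSNR_lt (hE : IsHomogeneousPPP μ lam E) (s : ℝ) :
    ((Measure.infinitePi fun _ : ℕ => gainLaw N).prod (μ.map fun ω j => E j ω))
        {z | ∀ j, combinedSNR A p α (z.2 j) (z.1 j) < s}
      = expNeg (lam * ∫⁻ x, snrTail A p α s x) := by
  have hEm : Measurable (fun ω j => E j ω) := measurable_pi_lambda _ hE.measurable
  have hm : ∀ j, Measurable fun z : (ℕ → Fin N → ℝ) × (ℕ → Plane) =>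
      combinedSNR A p α (z.2 j) (z.1 j) := fun j =>
    measurable_combinedSNR ((measurable_pi_apply j).comp measurable_snd)
      ((measurable_pi_apply j).comp measurable_fst)
  have hset : MeasurableSet {z : (ℕ → Fin N → ℝ) × (ℕ → Plane) |
      ∀ j, combinedSNR A p α (z.2 j) (z.1 j) < s} := by
    rw [Set.ofPred_forall]
    exact MeasurableSet.iInter fun j => measurableSet_lt (hm j) measurable_const
  have : IsProbabilityMeasure (μ.map fun ω j => E j ω) :=
    Measure.isProbabilityMeasure_map hEm.aemeasurable
  have htail : ∀ x, snrTail A p α s x ≤ 1 := fun x => prob_le_one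
  rw [Measure.prod_apply_symm hset, lintegral_map (measurable_measure_prodMk_right hset) hEm]
  -- With exp(-g) = 1 - T, the integrand 1 - exp(-g) of the Laplace functional is T itself.
  have key := hE.lintegral_expNeg_tsum (g := fun x => negLog (1 - snrTail A p α s x))
    (measurable_negLog.comp (measurable_const.sub (measurable_snrTail s)))
  simp only [expNeg_negLog tsub_le_self,
    ENNReal.sub_sub_cancel ENNReal.one_ne_top (htail _)] at key
  rw [← key]
  refine lintegral_congr fun ω => ?_
  have hT : ∀ j, MeasurableSet {u : Fin N → ℝ | combinedSNR A p α (E j ω) u < s} := fun j =>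
    measurableSet_lt (measurable_combinedSNR measurable_const measurable_id) measurable_const
  have hpi : (fun m : ℕ → Fin N → ℝ => (m, fun j => E j ω)) ⁻¹'
      {z | ∀ j, combinedSNR A p α (z.2 j) (z.1 j) < s}
      = Set.univ.pi fun j => {u | combinedSNR A p α (E j ω) u < s} := by
    ext m; simp [Set.mem_pi]
  rw [hpi, Measure.infinitePi_pi_univ _ hT,
    ← (expNeg_tsum fun j => negLog (1 - snrTail A p α s (E j ω))).tprod_eq]
  refine tprod_congr fun j => ?_
  have hge : MeasurableSet {u : Fin N → ℝ | s ≤ combinedSNR A p α (E j ω) u} :=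
    measurableSet_le measurable_const (measurable_combinedSNR measurable_const measurable_id)
  rw [expNeg_negLog tsub_le_self, snrTail, ← prob_compl_eq_one_sub hge]
  congr 1
  ext u; simp

/-- Only finitely many terms reach a level below `x 0`; the largest of these dominates all the
others. -/
lemma exists_isGreatest_of_finite {x : ℕ → ℝ} (h0 : 0 < x 0)
    (hfin : ∀ n : ℕ, {j | 1 / ((n : ℝ) + 1) ≤ x j}.Finite) :
    IsGreatest (Set.range x) (⨆ j, x j) := by
  obtain ⟨n, hn⟩ := exists_nat_one_div_lt h0
  obtain ⟨j, hj, hmax⟩ := Set.exists_max_image _ x (hfin n) ⟨0, hn.le⟩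
  have h : IsGreatest (Set.range x) (x j) := by
    refine ⟨⟨j, rfl⟩, ?_⟩
    rintro _ ⟨i, rfl⟩
    by_cases hi : 1 / ((n : ℝ) + 1) ≤ x i
    · exact hmax i hi
    · exact (not_le.1 hi).le.trans hj
  rw [iSup, h.csSup_eq]
  exact h

/-- Almost surely, some eavesdropper attains the largest combined SNR. -/
lemma ae_isGreatest_combinedSNR (hN : 1 ≤ N) (hp : ∀ i, 0 < p i) (hα : 0 < α)
    (hE : IsHomogeneousPPP μ lam E) {M : Ω → ℕ → Fin N → ℝ}
    (hM : HasLaw (fun ω => (M ω, fun j => E j ω))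
      ((Measure.infinitePi fun _ : ℕ => gainLaw N).prod (μ.map fun ω j => E j ω)) μ)
    (hMpos : ∀ᵐ ω ∂μ, ∀ k, 0 < M ω 0 k) :
    ∀ᵐ ω ∂μ, IsGreatest (Set.range fun j => combinedSNR A p α (E j ω) (M ω j))
      (⨆ j, combinedSNR A p α (E j ω) (M ω j)) := by
  have hEm : Measurable (fun ω j => E j ω) := measurable_pi_lambda _ hE.measurable
  have : IsProbabilityMeasure (μ.map fun ω j => E j ω) :=
    Measure.isProbabilityMeasure_map hEm.aemeasurable
  have hprob : ∀ s j, μ {ω | s ≤ combinedSNR A p α (E j ω) (M ω j)}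
      = ∫⁻ ω, snrTail A p α s (E j ω) ∂μ := by
    intro s j
    have hset : MeasurableSet {z : (ℕ → Fin N → ℝ) × (ℕ → Plane) |
        s ≤ combinedSNR A p α (z.2 j) (z.1 j)} :=
      measurableSet_le measurable_const (measurable_combinedSNR
        ((measurable_pi_apply j).comp measurable_snd) ((measurable_pi_apply j).comp measurable_fst))
    have h1 := hM.measure_eq hset
    rw [Measure.prod_apply_symm hset, lintegral_map (measurable_measure_prodMk_right hset) hEm] at h1
    rw [h1]
    refine lintegral_congr fun ω => ?_
    have hge : MeasurableSet {u : Fin N → ℝ | s ≤ combinedSNR A p α (E j ω) u} :=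
      measurableSet_le measurable_const (measurable_combinedSNR measurable_const measurable_id)
    exact (measurePreserving_eval_infinitePi (fun _ : ℕ => gainLaw N) j).measure_preimage
      hge.nullMeasurableSet
  have hfin : ∀ n : ℕ, ∀ᵐ ω ∂μ,
      {j | 1 / ((n : ℝ) + 1) ≤ combinedSNR A p α (E j ω) (M ω j)}.Finite := by
    intro n
    -- Borel–Cantelli: by Campbell's formula the probabilities sum to λ_E ∫ T, which is finite.
    refine ae_finite_setOfPred_mem
      (s := fun j => {ω | 1 / ((n : ℝ) + 1) ≤ combinedSNR A p α (E j ω) (M ω j)}) ?_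
    simp only [hprob]
    rw [hE.tsum_lintegral (measurable_snrTail _)]
    exact ENNReal.mul_ne_top (by simp) (lintegral_snrTail_ne_top hN hp hα (by positivity))
  filter_upwards [ae_all_iff.2 hfin, hMpos, hE.ae_forall (ae_forall_ne A)] with ω hω hpos hne
  refine exists_isGreatest_of_finite (Finset.sum_pos (fun k _ => ?_) ⟨⟨0, hN⟩, Finset.mem_univ _⟩) hω
  exact div_pos (mul_pos (hp k) (hpos k)) (Real.rpow_pos_of_pos (dist_pos.2 (hne 0 k)) _)

/-- The end-to-end SNR of the path whose links have the power gains `a`. -/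
def minSNR (A : Fin (N + 1) → Plane) (p : Fin N → ℝ) (α : ℝ) (a : Fin N → ℝ) : ℝ :=
  ⨅ i, p i * a i / dist (A i.castSucc) (A i.succ) ^ α

lemma measurable_minSNR : Measurable (minSNR A p α) :=
  Measurable.iInf fun i => by fun_prop

lemma minSNR_pos (hN : 1 ≤ N) (hA : Function.Injective A) (hp : ∀ i, 0 < p i) {a : Fin N → ℝ}
    (ha : ∀ i, 0 < a i) : 0 < minSNR A p α a := by
  have : Nonempty (Fin N) := ⟨⟨0, hN⟩⟩
  obtain ⟨i, hi⟩ := exists_eq_ciInf_of_finite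
    (f := fun i => p i * a i / dist (A i.castSucc) (A i.succ) ^ α)
  rw [minSNR, ← hi]
  exact div_pos (mul_pos (hp i) (ha i)) (Real.rpow_pos_of_pos
    (dist_pos.2 fun h => (Fin.castSucc_lt_succ (i := i)).ne (hA h)) _)

/-- The probability that no eavesdropper reaches the end-to-end SNR of the path. -/
lemma IsHomogeneousPPP.measure_forall_combinedSNR_lt_minSNR (hE : IsHomogeneousPPP μ lam E)
    {L : Ω → Fin N → ℝ} {M : Ω → ℕ → Fin N → ℝ}
    (hLM : HasLaw (fun ω => (L ω, (M ω, fun j => E j ω))) ((gainLaw N).prod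
      ((Measure.infinitePi fun _ : ℕ => gainLaw N).prod (μ.map fun ω j => E j ω))) μ) :
    AEMeasurable (fun ω => expNeg (lam * ∫⁻ x, snrTail A p α (minSNR A p α (L ω)) x)) μ ∧
    μ {ω | ∀ j, combinedSNR A p α (E j ω) (M ω j) < minSNR A p α (L ω)}
      = ∫⁻ ω, expNeg (lam * ∫⁻ x, snrTail A p α (minSNR A p α (L ω)) x) ∂μ := by
  have hEm : Measurable (fun ω j => E j ω) := measurable_pi_lambda _ hE.measurable
  have : IsProbabilityMeasure (μ.map fun ω j => E j ω) :=
    Measure.isProbabilityMeasure_map hEm.aemeasurable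
  have hset : MeasurableSet {z : (Fin N → ℝ) × (ℕ → Fin N → ℝ) × (ℕ → Plane) |
      ∀ j, combinedSNR A p α (z.2.2 j) (z.2.1 j) < minSNR A p α z.1} := by
    rw [Set.ofPred_forall]
    exact MeasurableSet.iInter fun j => measurableSet_lt
      (measurable_combinedSNR ((measurable_pi_apply j).comp (measurable_snd.comp measurable_snd))
        ((measurable_pi_apply j).comp (measurable_fst.comp measurable_snd)))
      (measurable_minSNR.comp measurable_fst)
  have hsec : ∀ a : Fin N → ℝ, ((Measure.infinitePi fun _ : ℕ => gainLaw N).prod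
      (μ.map fun ω j => E j ω)) (Prod.mk a ⁻¹' {z : (Fin N → ℝ) × (ℕ → Fin N → ℝ) × (ℕ → Plane) |
        ∀ j, combinedSNR A p α (z.2.2 j) (z.2.1 j) < minSNR A p α z.1})
      = expNeg (lam * ∫⁻ x, snrTail A p α (minSNR A p α a) x) :=
    fun a => hE.prod_setOf_forall_combinedSNR_lt (minSNR A p α a)
  have hmeas : Measurable fun a : Fin N → ℝ =>
      expNeg (lam * ∫⁻ x, snrTail A p α (minSNR A p α a) x) := by
    simp only [← hsec]
    exact measurable_measure_prodMk_left hset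
  have hL : HasLaw L (gainLaw N) μ :=
    ⟨measurable_fst.comp_aemeasurable hLM.aemeasurable, by
      have h := congrArg (Measure.map Prod.fst) hLM.map_eq
      rw [AEMeasurable.map_map_of_aemeasurable measurable_fst.aemeasurable hLM.aemeasurable,
        Measure.map_fst_prod, measure_univ, one_smul] at h
      exact h⟩
  refine ⟨hmeas.comp_aemeasurable hL.aemeasurable, ?_⟩
  rw [hLM.measure_eq hset, Measure.prod_apply hset, hL.lintegral_comp hmeas.aemeasurable]
  exact lintegral_congr hsec

end Eavesdropping

/-- Valid for every ω: both SNRs are nonnegative, even when an unbounded supremum takes the default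
value 0, so the logarithms are strictly monotone here. -/
lemma secrecyRate_pos_iff {Ω : Type*} {N : ℕ} (hN : 1 ≤ N) {A : Fin (N + 1) → Plane}
    {p : Fin N → ℝ} (hp : ∀ i, 0 < p i) {α : ℝ} {h : Fin N → Ω → ℂ} {hE : Fin N → ℕ → Ω → ℂ}
    {E : ℕ → Ω → Plane} {ω : Ω} :
    0 < secrecyRate A p α h hE E ω ↔ nonColludingSNR A p α hE E ω < pathSNR A p α h ω := by
  have h1 : 0 ≤ pathSNR A p α h ω := Real.iInf_nonneg fun i => by
    have := hp i
    unfold linkSNR; positivity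
  have h2 : 0 ≤ nonColludingSNR A p α hE E ω := Real.iSup_nonneg fun j =>
    Finset.sum_nonneg fun k _ => by
      have := hp k
      unfold eveSNR; positivity
  have hN' : (0 : ℝ) < 1 / N := by positivity
  rw [secrecyRate, mul_pos_iff_of_pos_left hN', sub_pos,
    Real.logb_lt_logb_iff one_lt_two (by positivity) (by positivity), add_lt_add_iff_left]

end SecureRouting

end

/-! ### Assembly -/

theorem mainTheorem2 {Ω : Type*} [MeasurableSpace Ω] (μ : Measure Ω) [IsProbabilityMeasure μ]
    -- the path, its transmit powers, the path loss exponent, the density of the eavesdroppers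
    (N : ℕ) (hN : 1 ≤ N) (A : Fin (N + 1) → SecureRouting.Plane) (hA : Function.Injective A)
    (p : Fin N → ℝ) (hp : ∀ i, 0 < p i) (α : ℝ) (hα : 0 < α) (lam : ℝ≥0) (hlam : 0 < lam)
    -- the eavesdroppers
    (E : ℕ → Ω → SecureRouting.Plane) (hPPP : SecureRouting.IsHomogeneousPPP μ lam E)
    -- the channel coefficients of the legitimate and of the eavesdropping links
    (h : Fin N → Ω → ℂ) (hE : Fin N → ℕ → Ω → ℂ)
    (h_law : ∀ i, HasLaw (fun ω => ‖h i ω‖ ^ 2) (expMeasure 1) μ)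
    (hE_law : ∀ k j, HasLaw (fun ω => ‖hE k j ω‖ ^ 2) (expMeasure 1) μ)
    -- all power gains are mutually independent, and independent of the eavesdroppers' locations
    (gains_indep : iIndepFun (fun (l : Fin N ⊕ Fin N × ℕ) (ω : Ω) =>
      Sum.elim (fun i => ‖h i ω‖ ^ 2) (fun kj => ‖hE kj.1 kj.2 ω‖ ^ 2) l) μ)
    (gains_locations_indep : IndepFun (fun (ω : Ω) (l : Fin N ⊕ Fin N × ℕ) =>
      Sum.elim (fun i => ‖h i ω‖ ^ 2) (fun kj => ‖hE kj.1 kj.2 ω‖ ^ 2) l)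
      (fun (ω : Ω) (j : ℕ) => E j ω) μ) :
    -- almost surely, the maximum over the eavesdroppers exists
    (∀ᵐ ω ∂μ, IsGreatest (Set.range fun j => SecureRouting.mrcSNR A p α hE E j ω)
      (SecureRouting.nonColludingSNR A p α hE E ω)) ∧
    -- almost surely, the integral over the plane converges
    (∀ᵐ ω ∂μ, Integrable
      (SecureRouting.integrand A p α (SecureRouting.pathSNR A p α h ω)) volume) ∧
    -- the expectation over the fading of the legitimate links exists
    Integrable (fun ω => Real.exp (-(lam : ℝ) * ∫ x : SecureRouting.Plane,
      SecureRouting.integrand A p α (SecureRouting.pathSNR A p α h ω) x)) μ ∧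
    SecureRouting.scp μ A p α h hE E =
      ∫ ω, Real.exp (-(lam : ℝ) * ∫ x : SecureRouting.Plane,
        SecureRouting.integrand A p α (SecureRouting.pathSNR A p α h ω) x) ∂μ := by
  open SecureRouting in
  have hlaw : ∀ l : Fin N ⊕ Fin N × ℕ, HasLaw (fun ω =>
      Sum.elim (fun i => ‖h i ω‖ ^ 2) (fun kj => ‖hE kj.1 kj.2 ω‖ ^ 2) l) (expMeasure 1) μ := by
    rintro (i | ⟨k, j⟩)
    exacts [h_law i, hE_law k j]
  have hjoint := hasLaw_gains_locations hPPP.measurable hlaw gains_indep gains_locations_indep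
  have hEm : Measurable (fun ω j => E j ω) := measurable_pi_lambda _ hPPP.measurable
  have : IsProbabilityMeasure (μ.map fun ω j => E j ω) :=
    Measure.isProbabilityMeasure_map hEm.aemeasurable
  have hM : HasLaw (fun ω => ((fun (j : ℕ) (k : Fin N) => ‖hE k j ω‖ ^ 2), fun j => E j ω))
      ((Measure.infinitePi fun _ : ℕ => gainLaw N).prod (μ.map fun ω j => E j ω)) μ :=
    ⟨measurable_snd.comp_aemeasurable hjoint.aemeasurable, by
      have h := congrArg (Measure.map Prod.snd) hjoint.map_eq
      rw [AEMeasurable.map_map_of_aemeasurable measurable_snd.aemeasurable hjoint.aemeasurable,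
        Measure.map_snd_prod, measure_univ, one_smul] at h
      exact h⟩
  have hpos : ∀ᵐ ω ∂μ, ∀ l : Fin N ⊕ Fin N × ℕ,
      0 < Sum.elim (fun i => ‖h i ω‖ ^ 2) (fun kj => ‖hE kj.1 kj.2 ω‖ ^ 2) l :=
    ae_all_iff.2 fun l => by
      have h := ae_pos_expMeasure one_pos
      rw [← (hlaw l).map_eq] at h
      exact ae_of_ae_map (hlaw l).aemeasurable h
  have hpath : ∀ᵐ ω ∂μ, 0 < pathSNR A p α h ω := by
    filter_upwards [hpos] with ω hω
    exact minSNR_pos hN hA hp (a := fun i => ‖h i ω‖ ^ 2) fun i => hω (Sum.inl i)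
  have hmax : ∀ᵐ ω ∂μ, IsGreatest (Set.range fun j => mrcSNR A p α hE E j ω)
      (nonColludingSNR A p α hE E ω) :=
    ae_isGreatest_combinedSNR hN hp hα hPPP hM
      (by filter_upwards [hpos] with ω hω k using hω (Sum.inr (k, 0)))
  obtain ⟨hmeas, hprob⟩ := hPPP.measure_forall_combinedSNR_lt_minSNR (A := A) (p := p) (α := α)
    (L := fun ω i => ‖h i ω‖ ^ 2) hjoint
  change AEMeasurable (fun ω => expNeg (lam * ∫⁻ x, snrTail A p α (pathSNR A p α h ω) x)) μ at hmeas
  have hexp : ∀ᵐ ω ∂μ, expNeg (lam * ∫⁻ x, snrTail A p α (pathSNR A p α h ω) x)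
      = ENNReal.ofReal (Real.exp (-(lam : ℝ) * ∫ x, integrand A p α (pathSNR A p α h ω) x)) := by
    filter_upwards [hpath] with ω hω using expNeg_mul_lintegral_snrTail hN hA hp hα lam hω
  have hexp' : (fun ω => (expNeg (lam * ∫⁻ x, snrTail A p α (pathSNR A p α h ω) x)).toReal)
      =ᵐ[μ] fun ω => Real.exp (-(lam : ℝ) * ∫ x, integrand A p α (pathSNR A p α h ω) x) := by
    filter_upwards [hexp] with ω hω
    rw [hω, ENNReal.toReal_ofReal (Real.exp_nonneg _)]
  have hle : ∫⁻ ω, expNeg (lam * ∫⁻ x, snrTail A p α (pathSNR A p α h ω) x) ∂μ ≠ ∞ :=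
    ((lintegral_mono fun _ => expNeg_le_one _).trans_lt (by simp)).ne
  have hlt : ∀ᵐ ω ∂μ, expNeg (lam * ∫⁻ x, snrTail A p α (pathSNR A p α h ω) x) < ∞ :=
    ae_of_all _ fun _ => (expNeg_le_one _).trans_lt ENNReal.one_lt_top
  refine ⟨hmax, ?_, (integrable_toReal_of_lintegral_ne_top hmeas hle).congr hexp', ?_⟩
  · filter_upwards [hpath] with ω hω using integrable_integrand hN hA hp hα hω
  · rw [← integral_congr_ae hexp', integral_toReal hmeas hlt]
    refine congrArg ENNReal.toReal (Eq.trans (measure_congr ?_) hprob)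
    -- Attainment matters: strict bounds on each eavesdropper would bound a mere supremum only
    -- weakly.
    filter_upwards [hmax] with ω hω
    refine propext ((secrecyRate_pos_iff hN hp).trans ⟨fun hlt j => ?_, fun hall => ?_⟩)
    · exact (hω.2 ⟨j, rfl⟩).trans_lt hlt
    · obtain ⟨j, hj⟩ := hω.1
      rw [← hj]
      exact hall j
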